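/- Let $d, p \ge 0$ be integers and let $\mathbf{K} = (K_1,\dots,K_p)$ be a $p$-tuple of convex bodies (nonempty compact convex sets, possibly with empty interior) in $\mathbb{R}^d$. Then there is a unique polynomial $v(\mathbf{K}) \in \mathbb{R}[w_1,\dots,w_p]$, the volume polynomial of $\mathbf{K}$, such that $v(\mathbf{K})(w_1,\dots,w_p) = \mathrm{Vol}_d(w_1K_1+\cdots+w_pK_p)$ for all real $w_1,\dots,w_p \ge 0$, and it is homogeneous of degree $d$; here sums and multiples are those of Minkowski and $\mathrm{Vol}_d$ is $d$-dimensional Lebesgue measure. For $\mathbf{n} = (n_1,\dots,n_p) \in \mathbb{N}^p$ let the mixed volume $V(\mathbf{K};\mathbf{n})$ be the coefficient of $w_1^{n_1}\cdots w_p^{n_p}$ in $v(\mathbf{K})$ divided by the multinomial coefficient $\frac{(n_1+\cdots+n_p)!}{n_1!\cdots n_p!}$; in particular $V(\mathbf{K};\mathbf{n}) = 0$ if $n_1+\cdots+n_p \ne d$. Then, for every $\mathbf{n} \in \mathbb{N}^p$, $$V(\mathbf{K};\mathbf{n}) > 0 \quad\Longleftrightarrow\quad \sum_{i=1}^p n_i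 = d \ \text{ and } \ \sum_{i\in J} n_i \le \dim\Big(\sum_{i\in J} K_i\Big) \text{ for every subset } J \subseteq \{1,\dots,p\},$$ where the dimension of a convex body is the dimension of its affine hull and the empty Minkowski sum is $\{0\}$. -/

import Mathlib

open scoped NNReal

namespace MixedVol

noncomputable section

/-- The dimension of a convex body: the dimension of its affine hull, i.e. of the linear
subspace spanned by the differences of its points. -/
def dim {d : ℕ} (K : ConvexBody (EuclideanSpace ℝ (Fin d))) : ℕ :=
  Module.finrank ℝ (vectorSpan ℝ (K : Set (EuclideanSpace ℝ (Fin d))))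

/-- `P` represents the function `w ↦ Vol_d (w₁ K₁ + ⋯ + w_p K_p)` on the nonnegative orthant;
sums and scalar multiples of convex bodies are those of Minkowski, and `Vol_d` is Lebesgue
measure. -/
def IsVolumePolynomial {d p : ℕ} (K : Fin p → ConvexBody (EuclideanSpace ℝ (Fin d)))
    (P : MvPolynomial (Fin p) ℝ) : Prop :=
  ∀ w : Fin p → ℝ≥0, MvPolynomial.eval (fun i => (w i : ℝ)) P =
    (MeasureTheory.volume
      ((∑ i, w i • K i : ConvexBody (EuclideanSpace ℝ (Fin d))) :
        Set (EuclideanSpace ℝ (Fin d)))).toReal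

/-- A polynomial is determined by its values on the nonnegative orthant. -/
theorem IsVolumePolynomial.unique {d p : ℕ}
    {K : Fin p → ConvexBody (EuclideanSpace ℝ (Fin d))} {P Q : MvPolynomial (Fin p) ℝ}
    (hP : IsVolumePolynomial K P) (hQ : IsVolumePolynomial K Q) : P = Q := by
  refine MvPolynomial.funext_set (fun _ => Set.Ici (0 : ℝ)) (fun _ => Set.Ici_infinite 0) ?_
  intro w hw
  have h0 : ∀ i, 0 ≤ w i := fun i => hw i (Set.mem_univ i)
  exact (hP fun i => ⟨w i, h0 i⟩).trans (hQ fun i => ⟨w i, h0 i⟩).symm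

open Classical in
/-- The volume polynomial of `K`, the unique polynomial `P` with `IsVolumePolynomial K P`. -/
def volumePolynomial {d p : ℕ} (K : Fin p → ConvexBody (EuclideanSpace ℝ (Fin d))) :
    MvPolynomial (Fin p) ℝ :=
  if h : ∃ P, IsVolumePolynomial K P then h.choose else 0

/-- The mixed volume `V(K; n)`: the coefficient of `w ^ n` in the volume polynomial divided by the
multinomial coefficient `(n₁ + ⋯ + n_p)! / (n₁! ⋯ n_p!)`. -/
def mixedVolume {d p : ℕ} (K : Fin p → ConvexBody (EuclideanSpace ℝ (Fin d)))
    (n : Fin p → ℕ) : ℝ :=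
  MvPolynomial.coeff (Finsupp.equivFunOnFinite.symm n) (volumePolynomial K) /
    (Nat.multinomial Finset.univ n : ℝ)

end

end MixedVol

/-!
Every convex body `K` has a smooth convex potential whose gradient maps the whole space into `K`,
with image containing the interior of `K`: the logarithm of the Laplace transform of a probability
measure whose support has `K` as its closed convex hull (`MixedVol.exists_isPotential`). The
Hessian at `x` is the covariance of the exponentially tilted measure. It is positive semidefinite,
and its kernel is the orthogonal complement of the direction of `K`, whatever `x` is.

Potentials are compatible with nonnegative Minkowski combinations
(`MixedVol.IsPotential.sum_smul`), so if `A i` is the Hessian belonging to `K i`, then the change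
of variables along the gradient gives `Vol (∑ i, w i • K i) = ∫ det (∑ i, w i • A i x) dx`
(`MixedVol.IsPotential.integral_det`). Expanding the determinant shows that this is a homogeneous
polynomial in `w` whose coefficients are sums of integrals of mixed discriminants of the `A i x`
(`MixedVol.isVolumePolynomial_sum`).

For positive semidefinite matrices the mixed discriminant is a sum of squares of determinants,
formed from one vector in each Gram factor (`MixedVol.mixedDisc_transpose_mul_self`). So it is
nonnegative, and it is positive exactly when independent vectors can be chosen from the ranges of
the matrices. By the Hall–Rado theorem this is the dimension condition on the directions of the
bodies (`MixedVol.mixedDisc_pos_iff`). The condition does not involve `x`: the integrand is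
positive everywhere or zero everywhere, and the same criterion decides whether the integral is
positive.
-/

namespace MixedVol

/-! ### The Hall–Rado theorem -/

section

open Module Submodule in
/-- The existence half of the Hall–Rado theorem, relative to a base subspace `U`: if the sets
`S j`, `j ∈ J`, raise the dimension of `U` by at least `|J|` for every `J ⊆ s`, then representatives
`v j ∈ S j` can be chosen that are linearly independent modulo `U`. Keeping `U` in the statement
plays the role of passing to quotients in the induction. -/
theorem exists_transversal {𝕜 E ι : Type*} [DivisionRing 𝕜] [AddCommGroup E] [Module 𝕜 E]
    [FiniteDimensional 𝕜 E] [DecidableEq ι] (S : ι → Set E) (s : Finset ι) (U : Submodule 𝕜 E)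
    (h : ∀ J ⊆ s, J.card + finrank 𝕜 U ≤ finrank 𝕜 ↥(U ⊔ span 𝕜 (⋃ j ∈ J, S j))) :
    ∃ v : ι → E, (∀ j ∈ s, v j ∈ S j) ∧
      s.card + finrank 𝕜 U ≤ finrank 𝕜 ↥(U ⊔ span 𝕜 (v '' s)) := by
  induction hn : s.card using Nat.strong_induction_on generalizing s U with
  | _ n ih =>
  subst hn
  rcases s.eq_empty_or_nonempty with rfl | ⟨i, hi⟩
  · exact ⟨fun _ => 0, by simp, by simpa using finrank_mono le_sup_left⟩
  -- Either some nonempty proper subfamily `J` is tight, and then `J` over `U` and `s \ J` over `U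
  -- ⊔ span (⋃ j ∈ J, S j)` are solved separately; or there is slack everywhere, and any vector of
  -- `S i` outside `U` can serve as the representative of `i`.
  by_cases htight : ∃ J ⊂ s, J.Nonempty ∧
      finrank 𝕜 ↥(U ⊔ span 𝕜 (⋃ j ∈ J, S j)) ≤ J.card + finrank 𝕜 U
  · obtain ⟨J, hJs, hJ, hJU⟩ := htight
    obtain ⟨v, hv, hvU⟩ := ih J.card (Finset.card_lt_card hJs) J U
      (fun J' hJ' => h J' (hJ'.trans hJs.1)) rfl
    have hle : U ⊔ span 𝕜 (v '' J) ≤ U ⊔ span 𝕜 (⋃ j ∈ J, S j) := by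
      refine sup_le_sup_left (span_mono ?_) _
      rintro _ ⟨j, hj, rfl⟩
      exact Set.mem_biUnion hj (hv j hj)
    have heq := eq_of_le_of_finrank_le hle (hJU.trans hvU)
    have hcard : (s \ J).card + J.card = s.card := Finset.card_sdiff_add_card_eq_card hJs.1
    obtain ⟨u, hu, huU⟩ := ih (s \ J).card (by have := hJ.card_pos; omega) (s \ J)
      (U ⊔ span 𝕜 (⋃ j ∈ J, S j)) (fun J' hJ' => by
        have hdisj : Disjoint J J' :=
          Finset.disjoint_of_subset_right hJ' Finset.disjoint_sdiff
        have := h (J ∪ J') (Finset.union_subset hJs.1 (hJ'.trans Finset.sdiff_subset))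
        rw [Finset.card_union_of_disjoint hdisj, Finset.set_biUnion_union, span_union,
          ← sup_assoc] at this
        omega) rfl
    refine ⟨fun j => if j ∈ J then v j else u j, fun j hj => ?_, ?_⟩
    · dsimp only
      split_ifs with hjJ
      · exact hv j hjJ
      · exact hu j (Finset.mem_sdiff.2 ⟨hj, hjJ⟩)
    · have hJ' := h J hJs.1
      have himg : v '' J ∪ u '' ↑(s \ J) ⊆ (fun j => if j ∈ J then v j else u j) '' s := by
        rintro _ (⟨j, hj, rfl⟩ | ⟨j, hj, rfl⟩)
        · exact ⟨j, hJs.1 hj, if_pos hj⟩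
        · have := Finset.mem_sdiff.1 hj
          exact ⟨j, this.1, if_neg this.2⟩
      have hmono : finrank 𝕜 ↥(U ⊔ span 𝕜 (v '' J) ⊔ span 𝕜 (u '' ↑(s \ J))) ≤
          finrank 𝕜 ↥(U ⊔ span 𝕜 ((fun j => if j ∈ J then v j else u j) '' s)) := by
        refine finrank_mono ?_
        rw [sup_assoc, ← span_union]
        exact sup_le_sup_left (span_mono himg) _
      rw [heq] at hmono
      omega
  · push Not at htight
    have hiU : ¬ S i ⊆ U := fun hsub => by
      have := h {i} (by simpa using hi)
      rw [Finset.set_biUnion_singleton, sup_of_le_left (span_le.2 hsub)] at this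
      simp at this
    obtain ⟨x, hxS, hxU⟩ := Set.not_subset.1 hiU
    have hx : finrank 𝕜 ↥(U ⊔ span 𝕜 {x}) = finrank 𝕜 U + 1 := by
      refine le_antisymm ((finrank_add_le_finrank_add_finrank _ _).trans
        (Nat.add_le_add_left (by simpa using finrank_span_le_card ({x} : Set E)) _)) ?_
      refine Nat.succ_le_of_lt (finrank_lt_finrank_of_lt ?_)
      refine lt_of_le_of_ne le_sup_left fun he => hxU ?_
      rw [he]
      exact mem_sup_right (mem_span_singleton_self x)
    have hcard := Finset.card_erase_add_one hi
    obtain ⟨u, hu, huU⟩ := ih (s.erase i).card (by omega) (s.erase i) (U ⊔ span 𝕜 {x})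
      (fun J' hJ' => by
        rcases J'.eq_empty_or_nonempty with rfl | hne
        · simpa using finrank_mono le_sup_left
        have := htight J' (hJ'.trans_ssubset (Finset.erase_ssubset hi)) hne
        have hm : finrank 𝕜 ↥(U ⊔ span 𝕜 (⋃ j ∈ J', S j)) ≤
            finrank 𝕜 ↥(U ⊔ span 𝕜 {x} ⊔ span 𝕜 (⋃ j ∈ J', S j)) :=
          finrank_mono (sup_le_sup_right le_sup_left _)
        omega) rfl
    refine ⟨fun j => if j = i then x else u j, fun j hj => ?_, ?_⟩
    · dsimp only
      split_ifs with hji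
      · exact hji ▸ hxS
      · exact hu j (Finset.mem_erase.2 ⟨hji, hj⟩)
    · have himg : {x} ∪ u '' ↑(s.erase i) ⊆ (fun j => if j = i then x else u j) '' s := by
        rintro _ (rfl | ⟨j, hj, rfl⟩)
        · exact ⟨i, hi, if_pos rfl⟩
        · have := Finset.mem_erase.1 hj
          exact ⟨j, this.2, if_neg this.1⟩
      have hmono : finrank 𝕜 ↥(U ⊔ span 𝕜 {x} ⊔ span 𝕜 (u '' ↑(s.erase i))) ≤
          finrank 𝕜 ↥(U ⊔ span 𝕜 ((fun j => if j = i then x else u j) '' s)) := by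
        refine finrank_mono ?_
        rw [sup_assoc, ← span_union]
        exact sup_le_sup_left (span_mono himg) _
      omega

open Module Submodule in
/-- The Hall–Rado theorem for a family of subsets of a finite-dimensional vector space. -/
theorem exists_linearIndependent_transversal_iff {𝕜 E ι : Type*} [DivisionRing 𝕜] [AddCommGroup E]
    [Module 𝕜 E] [FiniteDimensional 𝕜 E] [Fintype ι] (S : ι → Set E) :
    (∃ v : ι → E, (∀ j, v j ∈ S j) ∧ LinearIndependent 𝕜 v) ↔
      ∀ J : Finset ι, J.card ≤ finrank 𝕜 ↥(⨆ j ∈ J, span 𝕜 (S j)) := by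
  classical
  constructor
  · rintro ⟨v, hv, hli⟩ J
    have h1 := finrank_span_eq_card (hli.comp ((↑) : J → ι) Subtype.val_injective)
    rw [Fintype.card_coe] at h1
    rw [← h1]
    refine finrank_mono (span_le.2 ?_)
    rintro _ ⟨j, rfl⟩
    exact mem_iSup_of_mem j.1 (mem_iSup_of_mem j.2 (subset_span (hv j)))
  · intro h
    obtain ⟨v, hv, hcard⟩ := exists_transversal (𝕜 := 𝕜) S Finset.univ ⊥ fun J _ => by
      rw [bot_sup_eq, span_iUnion₂, finrank_bot]
      exact h J
    refine ⟨v, fun j => hv j (Finset.mem_univ j), ?_⟩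
    rw [linearIndependent_iff_card_le_finrank_span]
    rw [bot_sup_eq, finrank_bot, Finset.coe_univ, Set.image_univ] at hcard
    exact hcard

end

/-! ### Mixed discriminants -/

section

open Matrix Equiv

/-- The mixed discriminant of a family of matrices indexed by their rows, without the usual factor
`1 / (card m)!`: the sum over all permutations `σ` of the determinant of the matrix whose row `j` is
row `j` of `A (σ j)`. -/
def mixedDisc {m : Type*} [Fintype m] [DecidableEq m] (A : m → Matrix m m ℝ) : ℝ :=
  ∑ σ : Perm m, det (of fun j => A (σ j) j)

/-- Expansion of the determinant of a linear combination by multilinearity in the rows. -/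
theorem det_sum_smul {m ι : Type*} [Fintype m] [DecidableEq m] [Fintype ι] (w : ι → ℝ)
    (A : ι → Matrix m m ℝ) :
    det (∑ i, w i • A i) = ∑ g : m → ι, (∏ j, w (g j)) * det (of fun j => A (g j) j) := by
  have h1 : (∑ i, w i • A i) = of fun j => ∑ i, w i • A i j := by
    ext j k
    simp [Matrix.sum_apply]
  rw [h1]
  change detRowAlternating.toMultilinearMap (fun j => ∑ i, w i • A i j) = _
  rw [MultilinearMap.map_sum]
  refine Finset.sum_congr rfl fun g _ => ?_
  rw [MultilinearMap.map_smul_univ]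
  rfl

/-- The coefficients of `det (∑ i, w i • A i)`, as a polynomial in `w`, are mixed discriminants.
The expansion of `det_sum_smul` is averaged over permutations because its individual coefficients,
unlike the mixed discriminants, can be negative for positive semidefinite matrices. -/
theorem factorial_mul_det_sum_smul {m ι : Type*} [Fintype m] [DecidableEq m] [Fintype ι]
    (w : ι → ℝ) (A : ι → Matrix m m ℝ) :
    ((Fintype.card m).factorial : ℝ) * det (∑ i, w i • A i) =
      ∑ g : m → ι, (∏ j, w (g j)) * mixedDisc fun j => A (g j) := by
  simp_rw [mixedDisc, Finset.mul_sum]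
  rw [Finset.sum_comm, ← Fintype.card_perm, ← nsmul_eq_mul, ← Finset.card_univ, ← Finset.sum_const]
  refine Finset.sum_congr rfl fun σ _ => ?_
  rw [det_sum_smul]
  refine Fintype.sum_equiv (Equiv.arrowCongr σ (Equiv.refl ι)) _ _ fun g => ?_
  simp only [arrowCongr_apply, coe_refl, id_eq, Function.comp_apply, symm_apply_apply]
  rw [Equiv.prod_comp σ.symm fun j => w (g j)]

/-- A polarized Cauchy–Binet formula: the mixed discriminant of Gram matrices is a sum of squares.
-/
theorem mixedDisc_transpose_mul_self {m n : Type*} [Fintype m] [DecidableEq m] [Fintype n]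
    (B : m → Matrix n m ℝ) :
    mixedDisc (fun j => (B j)ᵀ * B j) = ∑ κ : m → n, det (of fun j => B j (κ j)) ^ 2 := by
  have key : ∀ σ : Perm m, det (of fun j => ((B (σ j))ᵀ * B (σ j)) j) =
      ∑ κ : m → n, (Perm.sign σ * ∏ j, B (σ j) (κ (σ j)) j) * det (of fun j => B j (κ j)) := by
    intro σ
    have h1 : (of fun j => ((B (σ j))ᵀ * B (σ j)) j) =
        of fun j => ∑ k, B (σ j) k j • B (σ j) k := by
      ext j l
      simp [Matrix.mul_apply]
    rw [h1]
    change detRowAlternating.toMultilinearMap (fun j => ∑ k, B (σ j) k j • B (σ j) k) = _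
    rw [MultilinearMap.map_sum]
    refine Fintype.sum_equiv (Equiv.arrowCongr σ (Equiv.refl n)) _ _ fun κ => ?_
    rw [MultilinearMap.map_smul_univ]
    simp only [arrowCongr_apply, coe_refl, id_eq, Function.comp_apply, symm_apply_apply]
    have h2 := det_permute σ (of fun j => B j (κ (σ.symm j)))
    have h3 : detRowAlternating.toMultilinearMap (fun j => B (σ j) (κ j)) =
      det ((of fun j => B j (κ (σ.symm j))).submatrix σ id) := by
      change det _ = _
      congr 1
      ext j l
      simp
    rw [h3, h2, smul_eq_mul]
    ring
  rw [mixedDisc, Finset.sum_congr rfl fun σ _ => key σ, Finset.sum_comm]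
  refine Finset.sum_congr rfl fun κ _ => ?_
  rw [← Finset.sum_mul, sq]
  congr 1
  rw [det_apply']
  rfl

open scoped MatrixOrder

variable {E m : Type*} [NormedAddCommGroup E] [InnerProductSpace ℝ E]
  [Fintype m] [DecidableEq m]

/-- A positive operator is a Gram operator `v ↦ ∑ k, ⟪b k, v⟫ b k`, stated both for its matrix in an
orthonormal basis and for its quadratic form. -/
theorem exists_toMatrix_eq_transpose_mul_self (b : OrthonormalBasis m ℝ E) {T : E →L[ℝ] E}
    (hT : T.IsPositive) :
    ∃ B : Matrix m m ℝ, LinearMap.toMatrix b.toBasis b.toBasis (T : E →ₗ[ℝ] E) = Bᵀ * B ∧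
      ∀ v, inner ℝ (T v) v = ∑ k, inner ℝ (b.repr.symm (WithLp.toLp 2 (B k))) v ^ 2 := by
  have hpos := (LinearMap.posSemidef_toMatrix_iff b).2 hT.toLinearMap
  obtain ⟨B, hB⟩ := CStarAlgebra.nonneg_iff_eq_star_mul_self.1 hpos.nonneg
  rw [star_eq_conjTranspose, conjTranspose_eq_transpose_of_trivial] at hB
  refine ⟨B, hB, fun v => ?_⟩
  have h1 : (b.repr (T v)).ofLp = Bᵀ *ᵥ B *ᵥ (b.repr v).ofLp := by
    have := LinearMap.toMatrix_mulVec_repr b.toBasis b.toBasis (T : E →ₗ[ℝ] E) v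
    rw [hB, ← mulVec_mulVec] at this
    exact this.symm
  have h2 : ∀ k, inner ℝ (b.repr.symm (WithLp.toLp 2 (B k))) v = (B *ᵥ (b.repr v).ofLp) k := by
    intro k
    rw [← b.repr.inner_map_map, b.repr.apply_symm_apply, EuclideanSpace.inner_eq_star_dotProduct,
      star_trivial, dotProduct_comm]
    rfl
  rw [← b.repr.inner_map_map, EuclideanSpace.inner_eq_star_dotProduct, h1, star_trivial,
    dotProduct_mulVec, vecMul_transpose]
  simp only [h2, dotProduct, sq]

/-- The mixed discriminant of positive operators `T j` is nonnegative, and it is positive exactly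
when the spaces `V j`, the orthogonal complements of the kernels, satisfy the Hall–Rado condition.
-/
theorem mixedDisc_pos_iff [FiniteDimensional ℝ E] (b : OrthonormalBasis m ℝ E) (T : m → E →L[ℝ] E)
    (hT : ∀ j, (T j).IsPositive) (V : m → Submodule ℝ E)
    (hV : ∀ j v, inner ℝ (T j v) v = 0 ↔ v ∈ (V j)ᗮ) :
    0 ≤ mixedDisc (fun j => LinearMap.toMatrix b.toBasis b.toBasis (T j : E →ₗ[ℝ] E)) ∧
    (0 < mixedDisc (fun j => LinearMap.toMatrix b.toBasis b.toBasis (T j : E →ₗ[ℝ] E)) ↔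
      ∀ J : Finset m, J.card ≤ Module.finrank ℝ ↥(⨆ j ∈ J, V j)) := by
  -- The rows of the Gram factor `B j` span `V j`; a nonzero square in the sum of squares is a
  -- choice of independent rows, one from each `B j`.
  choose B hB hBv using fun j => exists_toMatrix_eq_transpose_mul_self b (hT j)
  have hspan : ∀ j,
      Submodule.span ℝ (Set.range fun k => b.repr.symm (WithLp.toLp 2 (B j k))) = V j := by
    intro j
    rw [← Submodule.orthogonal_orthogonal (V j),
      ← Submodule.orthogonal_orthogonal (Submodule.span ℝ (Set.range _))]
    congr 1
    ext v
    rw [← hV, hBv, Finset.sum_eq_zero_iff_of_nonneg fun _ _ => sq_nonneg _]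
    simp only [Finset.mem_univ, true_imp_iff, sq_eq_zero_iff, Submodule.mem_orthogonal,
      Submodule.mem_span_range_iff_exists_fun]
    constructor
    · intro h k
      exact h _ ⟨Pi.single k 1, by simp [Pi.single_apply]⟩
    · rintro h _ ⟨c, rfl⟩
      simp [sum_inner, inner_smul_left, h]
  rw [funext hB, mixedDisc_transpose_mul_self]
  refine ⟨Finset.sum_nonneg fun _ _ => sq_nonneg _, ?_⟩
  rw [← funext hspan]
  rw [← exists_linearIndependent_transversal_iff,
    Finset.sum_pos_iff_of_nonneg fun _ _ => sq_nonneg _]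
  have hdet : ∀ κ : m → m, 0 < det (of fun j => B j (κ j)) ^ 2 ↔
      LinearIndependent ℝ fun j => b.repr.symm (WithLp.toLp 2 (B j (κ j))) := by
    intro κ
    rw [sq_pos_iff, ← isUnit_iff_ne_zero, ← isUnit_iff_isUnit_det,
      ← linearIndependent_rows_iff_isUnit,
      ← LinearMap.linearIndependent_iff ((WithLp.linearEquiv 2 ℝ (m → ℝ)).symm.trans
        b.repr.symm.toLinearEquiv).toLinearMap (LinearEquiv.ker _)]
    rfl
  constructor
  · rintro ⟨κ, -, hκ⟩
    exact ⟨_, fun j => Set.mem_range_self _, (hdet κ).1 hκ⟩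
  · rintro ⟨v, hv, hli⟩
    choose κ hκ using hv
    obtain rfl : (fun j => b.repr.symm (WithLp.toLp 2 (B j (κ j)))) = v := funext hκ
    exact ⟨κ, Finset.mem_univ κ, (hdet κ).2 hli⟩

end

/-! ### Potentials of convex bodies -/

section

open scoped Pointwise

variable {E : Type*} [NormedAddCommGroup E] [InnerProductSpace ℝ E]

/-- `φ` is a convex potential for the convex body `K`, with gradient `G` and Hessian `A`: the
gradient takes values in `K`, the form `v ↦ ⟪A x v, v⟫` is positive semidefinite and vanishes, for
every `x`, exactly on the orthogonal complement of the direction of `K`, and `φ` grows at least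
like the support function of `K` up to an error `ε ‖x‖ + c`, with `ε > 0` arbitrarily small. -/
structure IsPotential (K : ConvexBody E) (φ : E → ℝ) (G : E → E) (A : E → E →L[ℝ] E) : Prop where
  hasFDerivAt_potential : ∀ x, HasFDerivAt φ (innerSL ℝ (G x)) x
  hasFDerivAt_gradient : ∀ x, HasFDerivAt G (A x) x
  continuous_hessian : Continuous A
  isPositive : ∀ x, (A x).IsPositive
  inner_hessian_eq_zero_iff : ∀ x v,
    inner ℝ (A x v) v = 0 ↔ v ∈ (vectorSpan ℝ (K : Set E))ᗮ
  gradient_mem : ∀ x, G x ∈ K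
  lower_bound : ∀ ε > 0, ∃ c : ℝ, ∀ x, ∀ z ∈ K, inner ℝ x z - ε * ‖x‖ - c ≤ φ x

theorem hasFDerivAt_inner_const (z x : E) :
    HasFDerivAt (fun y : E => inner ℝ y z) (innerSL ℝ z) x := by
  have h1 : (fun y : E => inner ℝ y z) = innerSL ℝ z := funext fun y => real_inner_comm z y
  rw [h1]
  exact (innerSL ℝ z).hasFDerivAt

theorem vectorSpan_add {s t : Set E} (hs : s.Nonempty) (ht : t.Nonempty) :
    vectorSpan ℝ (s + t) = vectorSpan ℝ s ⊔ vectorSpan ℝ t := by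
  apply le_antisymm
  · rw [vectorSpan_def, Submodule.span_le]
    rintro _ ⟨_, ⟨a, ha, b, hb, rfl⟩, _, ⟨a', ha', b', hb', rfl⟩, rfl⟩
    have : (a + b) -ᵥ (a' + b') = (a -ᵥ a') + (b -ᵥ b') := by
      simp only [vsub_eq_sub]; abel
    dsimp only
    rw [this]
    exact Submodule.add_mem_sup (vsub_mem_vectorSpan ℝ ha ha') (vsub_mem_vectorSpan ℝ hb hb')
  · obtain ⟨a₀, ha₀⟩ := hs
    obtain ⟨b₀, hb₀⟩ := ht
    refine sup_le ?_ ?_ <;> rw [vectorSpan_def, Submodule.span_le]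
    · rintro _ ⟨a, ha, a', ha', rfl⟩
      have := vsub_mem_vectorSpan ℝ (Set.add_mem_add ha hb₀) (Set.add_mem_add ha' hb₀)
      simpa using this
    · rintro _ ⟨b, hb, b', hb', rfl⟩
      have := vsub_mem_vectorSpan ℝ (Set.add_mem_add ha₀ hb) (Set.add_mem_add ha₀ hb')
      simpa using this

theorem vectorSpan_coe_sum {ι : Type*} (s : Finset ι) (K : ι → ConvexBody E) :
    vectorSpan ℝ ((∑ i ∈ s, K i : ConvexBody E) : Set E) = ⨆ i ∈ s, vectorSpan ℝ (K i : Set E) := by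
  classical
  induction s using Finset.induction_on with
  | empty =>
    simp only [Finset.sum_empty, ConvexBody.coe_zero, Finset.notMem_empty, iSup_false, iSup_bot]
    exact vectorSpan_singleton ℝ (0 : E)
  | insert i s hi ih =>
    rw [Finset.sum_insert hi, ConvexBody.coe_add, vectorSpan_add (K i).nonempty
      (ConvexBody.nonempty _), ih, Finset.iSup_insert]

theorem IsPotential.zero : IsPotential (0 : ConvexBody E) (fun _ => 0) (fun _ => 0) fun _ => 0 where
  hasFDerivAt_potential x := by simpa using hasFDerivAt_const (0 : ℝ) x
  hasFDerivAt_gradient x := hasFDerivAt_const (0 : E) x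
  continuous_hessian := continuous_const
  isPositive x := ContinuousLinearMap.isPositive_zero
  inner_hessian_eq_zero_iff x v := by
    have : vectorSpan ℝ ((0 : ConvexBody E) : Set E) = ⊥ := vectorSpan_singleton ℝ (0 : E)
    rw [this]
    simp
  gradient_mem x := Set.mem_singleton (0 : E)
  lower_bound ε hε := ⟨0, fun x z hz => by
    obtain rfl : z = 0 := hz
    rw [inner_zero_right]
    have := mul_nonneg hε.le (norm_nonneg x)
    linarith⟩

theorem IsPotential.add {K L : ConvexBody E} {φ ψ : E → ℝ} {G H : E → E} {A B : E → E →L[ℝ] E}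
    (hK : IsPotential K φ G A) (hL : IsPotential L ψ H B) :
    IsPotential (K + L) (fun x => φ x + ψ x) (fun x => G x + H x) fun x => A x + B x where
  hasFDerivAt_potential x := by
    rw [map_add]
    exact (hK.hasFDerivAt_potential x).add (hL.hasFDerivAt_potential x)
  hasFDerivAt_gradient x := (hK.hasFDerivAt_gradient x).add (hL.hasFDerivAt_gradient x)
  continuous_hessian := hK.continuous_hessian.add hL.continuous_hessian
  isPositive x := (hK.isPositive x).add (hL.isPositive x)
  inner_hessian_eq_zero_iff x v := by
    rw [ConvexBody.coe_add, vectorSpan_add K.nonempty L.nonempty, ← Submodule.inf_orthogonal,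
      Submodule.mem_inf, ← hK.inner_hessian_eq_zero_iff x, ← hL.inner_hessian_eq_zero_iff x,
      add_apply, inner_add_left]
    exact add_eq_zero_iff_of_nonneg ((hK.isPositive x).inner_nonneg_left v)
      ((hL.isPositive x).inner_nonneg_left v)
  gradient_mem x := Set.add_mem_add (hK.gradient_mem x) (hL.gradient_mem x)
  lower_bound ε hε := by
    obtain ⟨c, hc⟩ := hK.lower_bound (ε / 2) (half_pos hε)
    obtain ⟨c', hc'⟩ := hL.lower_bound (ε / 2) (half_pos hε)
    refine ⟨c + c', fun x z hz => ?_⟩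
    obtain ⟨a, ha, b, hb, rfl⟩ := hz
    have h1 := hc x a ha
    have h2 := hc' x b hb
    simp only [inner_add_right]
    linarith

theorem IsPotential.smul {K : ConvexBody E} {φ : E → ℝ} {G : E → E} {A : E → E →L[ℝ] E}
    (hK : IsPotential K φ G A) (w : ℝ≥0) :
    IsPotential (w • K) (fun x => w * φ x) (fun x => (w : ℝ) • G x) fun x => (w : ℝ) • A x where
  hasFDerivAt_potential x := by
    rw [map_smul]
    exact (hK.hasFDerivAt_potential x).const_mul (w : ℝ)
  hasFDerivAt_gradient x := (hK.hasFDerivAt_gradient x).const_smul (w : ℝ)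
  continuous_hessian := hK.continuous_hessian.const_smul (w : ℝ)
  isPositive x := (hK.isPositive x).smul_of_nonneg w.2
  inner_hessian_eq_zero_iff x v := by
    have h1 : vectorSpan ℝ ((w • K : ConvexBody E) : Set E) =
        (vectorSpan ℝ (K : Set E)).map (LinearMap.lsmul ℝ E (w : ℝ)) := by
      rw [ConvexBody.coe_smul', ← LinearMap.toAffineMap_linear (LinearMap.lsmul ℝ E (w : ℝ)),
        AffineMap.map_vectorSpan]
      rfl
    rw [h1, smul_apply, inner_smul_left, mul_eq_zero,
      hK.inner_hessian_eq_zero_iff]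
    simp only [Submodule.mem_orthogonal, Submodule.mem_map, forall_exists_index, and_imp,
      forall_apply_eq_imp_iff₂, LinearMap.lsmul_apply, inner_smul_left, mul_eq_zero]
    by_cases hw : (w : ℝ) = 0 <;> simp [hw]
  gradient_mem x := Set.smul_mem_smul_set (hK.gradient_mem x)
  lower_bound ε hε := by
    -- `w + 1` instead of `w`, so that `w = 0` needs no separate treatment.
    have hw : (0 : ℝ) < w + 1 := by positivity
    obtain ⟨c, hc⟩ := hK.lower_bound (ε / (w + 1)) (by positivity)
    refine ⟨w * c, fun x z hz => ?_⟩
    obtain ⟨a, ha, rfl⟩ := hz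
    have h1 := mul_le_mul_of_nonneg_left (hc x a ha) w.2
    have h2 : (w : ℝ) * (ε / (w + 1)) ≤ ε := by
      rw [mul_div_assoc', div_le_iff₀ hw]
      nlinarith
    have h3 := mul_le_mul_of_nonneg_right h2 (norm_nonneg x)
    have h4 : inner ℝ x ((w : ℝ) • a) = w * inner ℝ x a := real_inner_smul_right x a w
    dsimp only
    rw [h4]
    change (w : ℝ) * _ ≤ (w : ℝ) * _ at h1
    nlinarith

/-- Potentials are compatible with nonnegative Minkowski combinations. -/
theorem IsPotential.sum_smul {ι : Type*} (s : Finset ι) {K : ι → ConvexBody E} {φ : ι → E → ℝ}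
    {G : ι → E → E} {A : ι → E → E →L[ℝ] E} (h : ∀ i, IsPotential (K i) (φ i) (G i) (A i))
    (w : ι → ℝ≥0) :
    IsPotential (∑ i ∈ s, w i • K i) (fun x => ∑ i ∈ s, w i * φ i x)
      (fun x => ∑ i ∈ s, (w i : ℝ) • G i x) fun x => ∑ i ∈ s, (w i : ℝ) • A i x := by
  classical
  induction s using Finset.induction_on with
  | empty => simpa using IsPotential.zero
  | insert i s hi ih =>
    simp only [Finset.sum_insert hi]
    exact ((h i).smul (w i)).add ih

end

/-! ### Existence of potentials -/

section

open Filter MeasureTheory ProbabilityTheory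

variable {E F : Type*} [NormedAddCommGroup E] [InnerProductSpace ℝ E] [NormedAddCommGroup F]
  [NormedSpace ℝ F]

theorem integrable_exp_inner_smul (ν : Measure ℕ) [IsFiniteMeasure ν] {z : ℕ → E} {R : ℝ}
    (hz : ∀ k, ‖z k‖ ≤ R) {f : ℕ → F} {C : ℝ} (hf : ∀ k, ‖f k‖ ≤ C) (x : E) :
    Integrable (fun k => Real.exp (inner ℝ x (z k)) • f k) ν := by
  refine Integrable.of_bound StronglyMeasurable.of_discrete.aestronglyMeasurable
    (Real.exp (‖x‖ * R) * C) (ae_of_all _ fun k => ?_)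
  rw [norm_smul, Real.norm_eq_abs, Real.abs_exp]
  refine mul_le_mul (Real.exp_le_exp.2 ?_) (hf k) (norm_nonneg _) (Real.exp_pos _).le
  exact (real_inner_le_norm _ _).trans (mul_le_mul_of_nonneg_left (hz k) (norm_nonneg x))

/-- Differentiation under the integral sign for a weighted Laplace transform. The result has the
same shape, with the weight `(innerSL ℝ (z k)).smulRight (f k)`, so that it can be iterated. -/
theorem hasFDerivAt_integral_exp_inner_smul (ν : Measure ℕ) [IsFiniteMeasure ν] {z : ℕ → E} {R : ℝ}
    (hz : ∀ k, ‖z k‖ ≤ R) {f : ℕ → F} {C : ℝ} (hf : ∀ k, ‖f k‖ ≤ C) (x : E) :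
    HasFDerivAt (fun x => ∫ k, Real.exp (inner ℝ x (z k)) • f k ∂ν)
      (∫ k, Real.exp (inner ℝ x (z k)) • (innerSL ℝ (z k)).smulRight (f k) ∂ν) x := by
  refine hasFDerivAt_integral_of_dominated_of_fderiv_le
    (F' := fun x k => Real.exp (inner ℝ x (z k)) • (innerSL ℝ (z k)).smulRight (f k))
    (bound := fun _ => Real.exp ((‖x‖ + 1) * R) * (R * C))
    (Metric.ball_mem_nhds x one_pos)
    (Eventually.of_forall fun _ => StronglyMeasurable.of_discrete.aestronglyMeasurable)
    (integrable_exp_inner_smul ν hz hf x) StronglyMeasurable.of_discrete.aestronglyMeasurable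
    (ae_of_all _ fun k y hy => ?_) (integrable_const _) (ae_of_all _ fun k y _ => ?_)
  · have hR : 0 ≤ R := (norm_nonneg _).trans (hz k)
    rw [norm_smul, Real.norm_eq_abs, Real.abs_exp, ContinuousLinearMap.norm_smulRight_apply,
      innerSL_apply_norm]
    refine mul_le_mul (Real.exp_le_exp.2 ?_)
      (mul_le_mul (hz k) (hf k) (norm_nonneg _) hR) (by positivity) (Real.exp_pos _).le
    refine (real_inner_le_norm _ _).trans (mul_le_mul ?_ (hz k) (norm_nonneg _) (by positivity))
    have h1 := norm_sub_norm_le y x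
    rw [mem_ball_iff_norm] at hy
    linarith
  · have h1 : HasFDerivAt (fun y : E => inner ℝ y (z k)) (innerSL ℝ (z k)) y :=
      hasFDerivAt_inner_const (z k) y
    have h2 := h1.exp.smul_const (f k)
    convert h2 using 1
    ext v
    simp [mul_smul]

/-- Every convex body has a potential: the logarithm of the Laplace transform of a probability
measure that charges every point of a dense sequence in the body. Its gradient and Hessian are the
mean and the covariance of the exponentially tilted measure. -/
theorem exists_isPotential [FiniteDimensional ℝ E] (K : ConvexBody E) :
    ∃ φ G A, IsPotential K φ G A := by
  have : ProperSpace E := FiniteDimensional.proper ℝ E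
  have : Nonempty (K : Set E) := K.nonempty.to_subtype
  obtain ⟨R, hR⟩ : ∃ R, ∀ y ∈ K, ‖y‖ ≤ R := K.isBounded.exists_norm_le
  set z : ℕ → E := fun k => (TopologicalSpace.denseSeq (K : Set E) k : E) with hz_def
  have hzK : ∀ k, z k ∈ K := fun k => (TopologicalSpace.denseSeq (K : Set E) k).2
  have hz : ∀ k, ‖z k‖ ≤ R := fun k => hR _ (hzK k)
  have hdense : ∀ y ∈ K, ∀ ε > 0, ∃ k, dist y (z k) < ε := fun y hy ε hε => by
    obtain ⟨k, hk⟩ := (TopologicalSpace.denseRange_denseSeq (K : Set E)).exists_dist_lt ⟨y, hy⟩ hε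
    exact ⟨k, hk⟩
  -- Any probability measure on `ℕ` charging every singleton would do.
  set ν : Measure ℕ := poissonMeasure 1
  have hν : ∀ k, 0 < ν.real {k} := fun k => poissonMeasure_real_singleton_pos k one_pos
  set M : E → ℝ := fun x => ∫ k, Real.exp (inner ℝ x (z k)) ∂ν with hM
  set N : E → E := fun x => ∫ k, Real.exp (inner ℝ x (z k)) • z k ∂ν with hN
  set D : E → E →L[ℝ] E := fun x =>
    ∫ k, Real.exp (inner ℝ x (z k)) • (innerSL ℝ (z k)).smulRight (z k) ∂ν with hD
  have hexp : ∀ x, Integrable (fun k => Real.exp (inner ℝ x (z k))) ν := fun x => by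
    simpa using integrable_exp_inner_smul ν hz (f := fun _ => (1 : ℝ)) (C := 1) (by simp) x
  have hexpz : ∀ x, Integrable (fun k => Real.exp (inner ℝ x (z k)) • z k) ν := fun x =>
    integrable_exp_inner_smul ν hz hz x
  have hnorm : ∀ k, ‖(innerSL ℝ (z k)).smulRight (z k)‖ ≤ R * R := fun k => by
    rw [ContinuousLinearMap.norm_smulRight_apply, innerSL_apply_norm]
    exact mul_le_mul (hz k) (hz k) (norm_nonneg _) ((norm_nonneg _).trans (hz k))
  have hexpzz : ∀ x, Integrable
      (fun k => Real.exp (inner ℝ x (z k)) • (innerSL ℝ (z k)).smulRight (z k)) ν := fun x =>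
    integrable_exp_inner_smul ν hz hnorm x
  have hMpos : ∀ x, 0 < M x := fun x => integral_exp_pos (hexp x)
  have hM' : ∀ x, HasFDerivAt M (innerSL ℝ (N x)) x := fun x => by
    have h1 := hasFDerivAt_integral_exp_inner_smul ν hz (f := fun _ => (1 : ℝ)) (C := 1)
      (by simp) x
    simp only [smul_eq_mul, mul_one] at h1
    have h2 : innerSL ℝ (N x) =
        ∫ k, Real.exp (inner ℝ x (z k)) • (innerSL ℝ (z k)).smulRight (1 : ℝ) ∂ν := by
      rw [hN, ← ContinuousLinearMap.integral_comp_comm _ (hexpz x)]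
      congr 1 with k v
      simp
      rfl
    rwa [h2]
  have hN' : ∀ x, HasFDerivAt N (D x) x := hasFDerivAt_integral_exp_inner_smul ν hz hz
  have hDc : Continuous D := continuous_iff_continuousAt.2 fun x =>
    (hasFDerivAt_integral_exp_inner_smul ν hz hnorm x).continuousAt
  have hMc : Continuous M := continuous_iff_continuousAt.2 fun x => (hM' x).continuousAt
  have hNc : Continuous N := continuous_iff_continuousAt.2 fun x => (hN' x).continuousAt
  set G : E → E := fun x => (M x)⁻¹ • N x with hG
  have hGc : Continuous G := (hMc.inv₀ fun x => (hMpos x).ne').smul hNc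
  have hNG : ∀ x, N x = M x • G x := fun x => by
    rw [hG, smul_smul, mul_inv_cancel₀ (hMpos x).ne', one_smul]
  have hGK : ∀ x, G x ∈ K := fun x => by
    have hprob : IsProbabilityMeasure (ν.tilted fun k => inner ℝ x (z k)) :=
      isProbabilityMeasure_tilted (hexp x)
    have h1 : G x = ∫ k, z k ∂(ν.tilted fun k => inner ℝ x (z k)) := by
      rw [integral_tilted]
      change (M x)⁻¹ • ∫ k, Real.exp (inner ℝ x (z k)) • z k ∂ν = _
      rw [← integral_smul]
      congr 1 with k
      rw [smul_smul, div_eq_inv_mul]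
    rw [h1]
    exact K.convex.integral_mem K.isClosed (ae_of_all _ hzK)
      (Integrable.of_bound StronglyMeasurable.of_discrete.aestronglyMeasurable R (ae_of_all _ hz))
  set A : E → E →L[ℝ] E := fun x => (M x)⁻¹ • D x - (innerSL ℝ (G x)).smulRight (G x) with hA
  have hDinner : ∀ x u v, inner ℝ (D x u) v =
      ∫ k, Real.exp (inner ℝ x (z k)) * (inner ℝ (z k) u * inner ℝ (z k) v) ∂ν := fun x u v => by
    rw [hD, ContinuousLinearMap.integral_apply (hexpzz x), real_inner_comm, ← integral_inner]
    · congr 1 with k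
      simp [inner_smul_right, real_inner_comm]
    · exact (hexpzz x).apply_continuousLinearMap u
  have hAinner : ∀ x u v, inner ℝ (A x u) v = (M x)⁻¹ *
      (∫ k, Real.exp (inner ℝ x (z k)) * (inner ℝ (z k) u * inner ℝ (z k) v) ∂ν) -
        inner ℝ (G x) u * inner ℝ (G x) v := fun x u v => by
    rw [← hDinner]
    simp [hA, inner_sub_left, inner_smul_left]
  have hvar_int : ∀ x v, Integrable
      (fun k => Real.exp (inner ℝ x (z k)) * inner ℝ (z k - G x) v ^ 2) ν := fun x v => by
    refine integrable_exp_inner_smul ν hz (f := fun k => inner ℝ (z k - G x) v ^ 2)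
      (C := ((R + R) * ‖v‖) ^ 2) (fun k => ?_) x
    rw [norm_pow]
    refine pow_le_pow_left₀ (norm_nonneg _) ((norm_inner_le_norm _ _).trans ?_) 2
    exact mul_le_mul_of_nonneg_right
      ((norm_sub_le _ _).trans (add_le_add (hz k) (hR _ (hGK x)))) (norm_nonneg v)
  -- `A x` is the covariance: its quadratic form is the tilted variance of `⟪z, v⟫`.
  have hvar : ∀ x v, inner ℝ (A x v) v = (M x)⁻¹ *
      ∫ k, Real.exp (inner ℝ x (z k)) * inner ℝ (z k - G x) v ^ 2 ∂ν := fun x v => by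
    have hi1 : Integrable
        (fun k => Real.exp (inner ℝ x (z k)) * (inner ℝ (z k) v * inner ℝ (z k) v)) ν := by
      refine integrable_exp_inner_smul ν hz (f := fun k => inner ℝ (z k) v * inner ℝ (z k) v)
        (C := (R * ‖v‖) * (R * ‖v‖)) (fun k => ?_) x
      have := (norm_inner_le_norm (𝕜 := ℝ) (z k) v).trans
        (mul_le_mul_of_nonneg_right (hz k) (norm_nonneg v))
      rw [norm_mul]
      exact mul_le_mul this this (norm_nonneg _) ((norm_nonneg _).trans this)
    have hi2 : Integrable (fun k => inner ℝ v (Real.exp (inner ℝ x (z k)) • z k)) ν :=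
      (innerSL ℝ v).integrable_comp (hexpz x)
    have h1 : ∀ k, Real.exp (inner ℝ x (z k)) * inner ℝ (z k - G x) v ^ 2 =
        Real.exp (inner ℝ x (z k)) * (inner ℝ (z k) v * inner ℝ (z k) v) -
        2 * inner ℝ (G x) v * inner ℝ v (Real.exp (inner ℝ x (z k)) • z k) +
        inner ℝ (G x) v ^ 2 * Real.exp (inner ℝ x (z k)) := fun k => by
      rw [inner_sub_left, inner_smul_right, real_inner_comm (z k) v]
      ring
    have hN2 : ∫ k, inner ℝ v (Real.exp (inner ℝ x (z k)) • z k) ∂ν =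
        M x * inner ℝ (G x) v := by
      rw [integral_inner (hexpz x)]
      change inner ℝ v (N x) = _
      rw [hNG, inner_smul_right, real_inner_comm]
    rw [hAinner]
    simp_rw [h1]
    have hi3 := hi2.const_mul (2 * inner ℝ (G x) v)
    rw [integral_add (by exact hi1.sub hi3) ((hexp x).const_mul _),
      integral_sub hi1 hi3, integral_const_mul, integral_const_mul, hN2]
    change _ = (M x)⁻¹ * (_ - _ + _ * M x)
    have := (hMpos x).ne'
    field_simp
    ring
  refine ⟨fun x => Real.log (M x), G, A, ?_, ?_, ?_, ?_, ?_, hGK, ?_⟩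
  · intro x
    rw [hG, map_smul]
    exact (hM' x).log (hMpos x).ne'
  · intro x
    have h1 := ((hasDerivAt_inv (hMpos x).ne').comp_hasFDerivAt x (hM' x)).smul (hN' x)
    have h2 : A x = (M x)⁻¹ • D x + (-(M x ^ 2)⁻¹ • innerSL ℝ (N x)).smulRight (N x) := by
      ext v
      simp [hA, hG, smul_smul, sub_eq_add_neg]
      ring_nf
    rw [h2]
    exact h1
  · refine ((hMc.inv₀ fun x => (hMpos x).ne').smul hDc).sub ?_
    have := ((innerSL ℝ (E := E)).continuous.comp hGc)
    exact ((ContinuousLinearMap.smulRightL ℝ E E).continuous.comp this).clm_apply hGc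
  · intro x
    refine ⟨fun u v => ?_, fun v => ?_⟩
    · change inner ℝ (A x u) v = inner ℝ u (A x v)
      rw [← real_inner_comm u (A x v), hAinner, hAinner]
      simp_rw [mul_comm (inner ℝ _ u)]
    · change 0 ≤ inner ℝ (A x v) v
      rw [hvar]
      exact mul_nonneg (inv_pos.2 (hMpos x)).le (integral_nonneg fun k => by positivity)
  · intro x v
    rw [hvar, mul_eq_zero_iff_left (inv_pos.2 (hMpos x)).ne',
      integral_eq_zero_iff_of_nonneg (fun k => by positivity) (hvar_int x v), EventuallyEq,
      ae_iff_of_countable]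
    constructor
    · intro h
      have h1 : ∀ k, inner ℝ (z k - G x) v = 0 := fun k => by
        have hk : ν {k} ≠ 0 := fun h0 => (hν k).ne' (by simp [Measure.real, h0])
        simpa using h k hk
      have h2 : ∀ y : (K : Set E), inner ℝ ((y : E) - G x) v = 0 := fun y => by
        have hc : Continuous fun y : (K : Set E) => inner ℝ ((y : E) - G x) v := by fun_prop
        exact congrFun ((TopologicalSpace.denseRange_denseSeq (K : Set E)).equalizer
          hc (continuous_const (y := (0 : ℝ))) (funext h1)) y
      rw [Submodule.mem_orthogonal, vectorSpan_def]
      intro u hu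
      induction hu using Submodule.span_induction with
      | mem u hu =>
        obtain ⟨a, ha, b, hb, rfl⟩ := hu
        have h3 := h2 ⟨a, ha⟩
        have h4 := h2 ⟨b, hb⟩
        simp only [vsub_eq_sub, inner_sub_left] at h3 h4 ⊢
        linarith
      | zero => exact inner_zero_left v
      | add a b _ _ ha hb => rw [inner_add_left, ha, hb, add_zero]
      | smul c a _ ha => rw [inner_smul_left, ha, mul_zero]
    · intro h k _
      have := h _ (vsub_mem_vectorSpan ℝ (hzK k) (hGK x))
      rw [vsub_eq_sub] at this
      simp [this]
  · intro ε hε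
    -- Finitely many balls around points `z k` cover `K`, so the integral defining `M x` is bounded
    -- below by the contribution of a single `z k` close to the given point.
    obtain ⟨t, ht⟩ := K.isCompact.elim_finite_subcover (fun k => Metric.ball (z k) ε)
      (fun k => Metric.isOpen_ball) (fun y hy => by
        obtain ⟨k, hk⟩ := hdense y hy ε hε
        exact Set.mem_iUnion.2 ⟨k, hk⟩)
    refine ⟨∑ k ∈ t, |Real.log (ν.real {k})|, fun x y hy => ?_⟩
    obtain ⟨k, hkt, hk⟩ := Set.mem_iUnion₂.1 (ht hy)
    have h1 : ν.real {k} * Real.exp (inner ℝ x (z k)) ≤ M x := by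
      have := setIntegral_le_integral (hexp x) (ae_of_all ν fun k => (Real.exp_pos _).le)
        (s := {k})
      rwa [integral_singleton, smul_eq_mul] at this
    have h2 := Real.log_le_log (mul_pos (hν k) (Real.exp_pos _)) h1
    rw [Real.log_mul (hν k).ne' (Real.exp_pos _).ne', Real.log_exp] at h2
    have h3 := Finset.single_le_sum (f := fun k => |Real.log (ν.real {k})|)
      (fun _ _ => abs_nonneg _) hkt
    have h4 := neg_abs_le (Real.log (ν.real {k}))
    have h5 : inner ℝ x (y - z k) ≤ ‖x‖ * ε := (real_inner_le_norm _ _).trans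
      (mul_le_mul_of_nonneg_left (mem_ball_iff_norm.1 hk).le (norm_nonneg x))
    rw [inner_sub_right] at h5
    linarith

end

/-! ### Volume as the integral of the Hessian determinant -/

section

open Filter MeasureTheory

variable {E : Type*} [NormedAddCommGroup E] [InnerProductSpace ℝ E]
  {K : ConvexBody E} {φ : E → ℝ} {G : E → E} {A : E → E →L[ℝ] E}

/-- For `y` in the interior of `K`, the function `φ - ⟪·, y⟫` is coercive, and the gradient of `φ`
at a minimizer is `y`. -/
theorem IsPotential.exists_gradient_eq [FiniteDimensional ℝ E] (h : IsPotential K φ G A) {y : E}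
    (hy : y ∈ interior (K : Set E)) : ∃ x, G x = y := by
  obtain ⟨r, hr, hball⟩ := Metric.mem_nhds_iff.1 (mem_interior_iff_mem_nhds.1 hy)
  obtain ⟨c, hc⟩ := h.lower_bound (r / 4) (by positivity)
  have : ProperSpace E := FiniteDimensional.proper ℝ E
  have hbound : ∀ x, r / 4 * ‖x‖ - c ≤ φ x - inner ℝ x y := fun x => by
    -- The lower bound is used at the point of `K` at distance `r / 2` from `y` in direction `x`.
    have hmem : y + (r / 2 * ‖x‖⁻¹) • x ∈ K := by
      refine hball ?_
      rw [mem_ball_iff_norm, add_sub_cancel_left, norm_smul, Real.norm_eq_abs,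
        abs_of_nonneg (by positivity), mul_assoc]
      have : ‖x‖⁻¹ * ‖x‖ ≤ 1 := inv_mul_le_one
      nlinarith
    have h1 := hc x _ hmem
    rw [inner_add_right, inner_smul_right, real_inner_self_eq_norm_sq] at h1
    have h2 : r / 2 * ‖x‖⁻¹ * ‖x‖ ^ 2 = r / 2 * ‖x‖ := by
      rcases eq_or_ne ‖x‖ 0 with h0 | h0
      · simp [h0]
      · field_simp
    rw [h2] at h1
    linarith
  have hd : ∀ x, HasFDerivAt (fun x => φ x - inner ℝ x y) (innerSL ℝ (G x) - innerSL ℝ y) x :=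
    fun x => by
      exact (h.hasFDerivAt_potential x).sub (hasFDerivAt_inner_const y x)
  have htend : Tendsto (fun x => φ x - inner ℝ x y) (cocompact E) atTop := by
    refine tendsto_atTop_mono hbound ?_
    refine tendsto_atTop_add_const_right _ _ ?_
    exact (tendsto_norm_cocompact_atTop (E := E)).const_mul_atTop (by positivity)
  obtain ⟨x, hx⟩ := Continuous.exists_forall_le
    (continuous_iff_continuousAt.2 fun x => (hd x).continuousAt) htend
  refine ⟨x, ?_⟩
  have h0 := IsLocalMin.hasFDerivAt_eq_zero (Eventually.of_forall hx) (hd x)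
  rw [← map_sub] at h0
  have h1 := congrArg (fun f : E →L[ℝ] ℝ => f (G x - y)) h0
  simp only [innerSL_apply_apply, zero_apply, inner_self_eq_zero] at h1
  exact sub_eq_zero.1 h1

theorem IsPotential.injective_gradient (h : IsPotential K φ G A)
    (hK : vectorSpan ℝ (K : Set E) = ⊤) : Function.Injective G := by
  intro x y hxy
  by_contra hne
  have hv : y - x ≠ 0 := sub_ne_zero.2 (Ne.symm hne)
  have hd : ∀ t : ℝ, HasDerivAt (fun t : ℝ => inner ℝ (y - x) (G (x + t • (y - x))))
      (inner ℝ (y - x) (A (x + t • (y - x)) (y - x))) t := fun t => by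
    have h1 : HasDerivAt (fun t : ℝ => x + t • (y - x)) (y - x) t := by
      simpa using ((hasDerivAt_id t).smul_const (y - x)).const_add x
    exact (innerSL ℝ (y - x)).hasFDerivAt.comp_hasDerivAt t
      ((h.hasFDerivAt_gradient _).comp_hasDerivAt t h1)
  have hmono : StrictMono fun t : ℝ => inner ℝ (y - x) (G (x + t • (y - x))) := by
    refine strictMono_of_deriv_pos fun t => ?_
    rw [(hd t).deriv, real_inner_comm]
    refine lt_of_le_of_ne ((h.isPositive _).inner_nonneg_left _) fun h0 => hv ?_
    have := (h.inner_hessian_eq_zero_iff _ _).1 h0.symm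
    rwa [hK, Submodule.top_orthogonal_eq_bot, Submodule.mem_bot] at this
  have := hmono zero_lt_one
  simp [hxy] at this

theorem IsPotential.det_nonneg [FiniteDimensional ℝ E] (h : IsPotential K φ G A) (x : E) :
    0 ≤ (A x).det := by
  rw [ContinuousLinearMap.det, ← LinearMap.det_toMatrix (stdOrthonormalBasis ℝ E).toBasis]
  exact ((LinearMap.posSemidef_toMatrix_iff _).2 (h.isPositive x).toLinearMap).det_nonneg

/-- Change of variables along the gradient map, which is a bijection onto `K` up to a null set
when `K` has full dimension; otherwise the volume of `K` and the determinant of the Hessian both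
vanish. -/
theorem IsPotential.lintegral_det [FiniteDimensional ℝ E] [MeasurableSpace E] [BorelSpace E]
    (μ : Measure E) [μ.IsAddHaarMeasure] (h : IsPotential K φ G A) :
    ∫⁻ x, ENNReal.ofReal (A x).det ∂μ = μ K := by
  by_cases hK : vectorSpan ℝ (K : Set E) = ⊤
  · have h1 := lintegral_abs_det_fderiv_eq_addHaar_image μ MeasurableSet.univ
      (fun x _ => (h.hasFDerivAt_gradient x).hasFDerivWithinAt) (h.injective_gradient hK).injOn
    simp_rw [abs_of_nonneg (h.det_nonneg _)] at h1
    rw [setLIntegral_univ] at h1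
    rw [h1, Set.image_univ]
    refine le_antisymm (measure_mono (Set.range_subset_iff.2 h.gradient_mem)) ?_
    have h2 : (K : Set E) ⊆ interior K ∪ frontier K := by
      rw [← closure_eq_interior_union_frontier]
      exact subset_closure
    calc μ K ≤ μ (interior K ∪ frontier K) := measure_mono h2
      _ ≤ μ (interior K) + μ (frontier K) := measure_union_le _ _
      _ = μ (interior K) := by rw [K.convex.addHaar_frontier μ, add_zero]
      _ ≤ μ (Set.range G) := measure_mono fun y hy => h.exists_gradient_eq hy
  · have h1 : μ K = 0 := by
      refine measure_mono_null (subset_affineSpan ℝ (K : Set E))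
        (Measure.addHaar_affineSubspace μ _ fun h0 => hK ?_)
      rw [← direction_affineSpan, h0, AffineSubspace.direction_top]
    have h2 : ∀ x, (A x).det = 0 := fun x => by
      by_contra hdet
      -- The mixed discriminant of copies of `A x` is a multiple of `det (A x)`; were it positive,
      -- the Hall–Rado condition would force the direction of `K` to be the whole space.
      set b := stdOrthonormalBasis ℝ E
      have h3 := (mixedDisc_pos_iff b (fun _ => A x) (fun _ => h.isPositive x)
        (fun _ => vectorSpan ℝ (K : Set E)) fun _ => h.inner_hessian_eq_zero_iff x).2
      have h4 : mixedDisc (fun _ => LinearMap.toMatrix b.toBasis b.toBasis (A x : E →ₗ[ℝ] E)) =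
          (Module.finrank ℝ E).factorial * (A x).det := by
        rw [ContinuousLinearMap.det, ← LinearMap.det_toMatrix b.toBasis, mixedDisc,
          Finset.sum_const, Finset.card_univ, Fintype.card_perm, Fintype.card_fin, nsmul_eq_mul]
        rfl
      rw [h4] at h3
      have h5 := h3.1 (mul_pos (by positivity)
        (lt_of_le_of_ne (h.det_nonneg x) (Ne.symm hdet))) Finset.univ
      rw [Finset.card_univ, Fintype.card_fin] at h5
      refine hK (Submodule.eq_top_of_finrank_eq (le_antisymm (Submodule.finrank_le _) ?_))
      exact h5.trans (Submodule.finrank_mono (iSup₂_le fun _ _ => le_rfl))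
    simp [h1, h2]

theorem IsPotential.integrable_det [FiniteDimensional ℝ E] [MeasurableSpace E] [BorelSpace E]
    (μ : Measure E) [μ.IsAddHaarMeasure] (h : IsPotential K φ G A) :
    Integrable (fun x => (A x).det) μ := by
  refine ⟨(ContinuousLinearMap.continuous_det.comp h.continuous_hessian).aestronglyMeasurable, ?_⟩
  rw [hasFiniteIntegral_iff_ofReal (ae_of_all _ h.det_nonneg), h.lintegral_det μ]
  exact K.isCompact.measure_lt_top

theorem IsPotential.integral_det [FiniteDimensional ℝ E] [MeasurableSpace E] [BorelSpace E]
    (μ : Measure E) [μ.IsAddHaarMeasure] (h : IsPotential K φ G A) :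
    ∫ x, (A x).det ∂μ = (μ K).toReal := by
  rw [← h.lintegral_det μ, integral_eq_lintegral_of_nonneg_ae (ae_of_all _ h.det_nonneg)
    (h.integrable_det μ).1]

end

/-! ### Families with repetitions -/

section

theorem sum_eq_card_filter_mem {ι κ : Type*} [Fintype κ] [DecidableEq ι] {g : κ → ι} {n : ι → ℕ}
    (h : ∀ i, n i = (Finset.univ.filter fun j => g j = i).card) (J : Finset ι) :
    ∑ i ∈ J, n i = (Finset.univ.filter fun j => g j ∈ J).card := by
  rw [Finset.card_eq_sum_card_fiberwise (f := g) (t := J) fun j hj => by simpa using hj]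
  refine Finset.sum_congr rfl fun i hi => ?_
  rw [h, Finset.filter_filter]
  congr 1
  ext j
  simp only [Finset.mem_filter, Finset.mem_univ, true_and]
  exact ⟨fun hj => ⟨hj ▸ hi, hj⟩, fun hj => hj.2⟩

theorem exists_fiber_card_eq_iff {ι κ : Type*} [Fintype ι] [Fintype κ] [DecidableEq ι]
    (n : ι → ℕ) :
    (∃ g : κ → ι, ∀ i, n i = (Finset.univ.filter fun j => g j = i).card) ↔
      ∑ i, n i = Fintype.card κ := by
  constructor
  · rintro ⟨g, hg⟩
    simpa using sum_eq_card_filter_mem hg Finset.univ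
  · intro h
    let e : κ ≃ Σ i, Fin (n i) := Fintype.equivOfCardEq (by simp [h])
    refine ⟨fun j => (e j).1, fun i => ?_⟩
    rw [← Fintype.card_subtype, ← Fintype.card_fin (n i)]
    exact Fintype.card_congr ((Equiv.sigmaSubtype (β := fun i => Fin (n i)) i).symm.trans
      (e.subtypeEquiv fun j => Iff.rfl).symm)

/-- When each `i` is repeated `n i` times by the map `g`, the Hall–Rado condition for the repeated
family is the weighted condition for the original one. -/
theorem forall_card_le_iff {𝕜 E ι κ : Type*} [DivisionRing 𝕜] [AddCommGroup E] [Module 𝕜 E]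
    [FiniteDimensional 𝕜 E] [Fintype κ] [DecidableEq ι] {g : κ → ι} {n : ι → ℕ}
    (h : ∀ i, n i = (Finset.univ.filter fun j => g j = i).card) (V : ι → Submodule 𝕜 E) :
    (∀ J : Finset κ, J.card ≤ Module.finrank 𝕜 ↥(⨆ j ∈ J, V (g j))) ↔
      ∀ J : Finset ι, ∑ i ∈ J, n i ≤ Module.finrank 𝕜 ↥(⨆ i ∈ J, V i) := by
  constructor
  · intro H J
    rw [sum_eq_card_filter_mem h]
    refine (H _).trans (Submodule.finrank_mono (iSup₂_le fun j hj => ?_))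
    exact le_iSup₂_of_le (g j) (Finset.mem_filter.1 hj).2 le_rfl
  · intro H J
    have h1 := H (J.image g)
    rw [sum_eq_card_filter_mem h] at h1
    refine (Finset.card_le_card fun j hj => ?_).trans (h1.trans (Submodule.finrank_mono ?_))
    · simpa using ⟨j, hj, rfl⟩
    · refine iSup₂_le fun i hi => ?_
      obtain ⟨j, hj, rfl⟩ := Finset.mem_image.1 hi
      exact le_iSup₂_of_le j hj le_rfl

open MvPolynomial in
theorem coeff_sum_C_mul_prod_X {ι κ : Type*} [Fintype ι] [Fintype κ] [DecidableEq ι]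
    [DecidableEq κ] (c : (κ → ι) → ℝ) (n : ι → ℕ) :
    coeff (Finsupp.equivFunOnFinite.symm n) (∑ g : κ → ι, C (c g) * ∏ j, X (g j)) =
      ∑ g with ∀ i, n i = (Finset.univ.filter fun j => g j = i).card, c g := by
  rw [coeff_sum, Finset.sum_filter]
  refine Finset.sum_congr rfl fun g _ => ?_
  have h1 : (∏ j, X (g j) : MvPolynomial ι ℝ) = monomial (∑ j, Finsupp.single (g j) 1) 1 := by
    rw [monomial_sum_one]
    rfl
  rw [h1, C_mul_monomial, mul_one, coeff_monomial]
  refine if_congr ?_ rfl rfl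
  rw [DFunLike.ext_iff]
  refine forall_congr' fun i => ?_
  rw [Finsupp.finsetSum_apply, Finsupp.equivFunOnFinite_symm_apply_apply, Finset.card_filter,
    eq_comm]
  simp only [Finsupp.single_apply]

end

/-! ### The volume polynomial -/

section

open MeasureTheory

variable {d p : ℕ} {K : Fin p → ConvexBody (EuclideanSpace ℝ (Fin d))}
  {φ : Fin p → EuclideanSpace ℝ (Fin d) → ℝ}
  {G : Fin p → EuclideanSpace ℝ (Fin d) → EuclideanSpace ℝ (Fin d)}
  {A : Fin p → EuclideanSpace ℝ (Fin d) → EuclideanSpace ℝ (Fin d) →L[ℝ] EuclideanSpace ℝ (Fin d)}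

/-- The mixed discriminant of the Hessians `A (g 0) x, …, A (g (d - 1)) x`, in the standard basis.
-/
noncomputable def mixedHessian (A : Fin p → EuclideanSpace ℝ (Fin d) →
    EuclideanSpace ℝ (Fin d) →L[ℝ] EuclideanSpace ℝ (Fin d)) (g : Fin d → Fin p)
    (x : EuclideanSpace ℝ (Fin d)) : ℝ :=
  mixedDisc fun j => LinearMap.toMatrix (EuclideanSpace.basisFun (Fin d) ℝ).toBasis
    (EuclideanSpace.basisFun (Fin d) ℝ).toBasis
    (A (g j) x : EuclideanSpace ℝ (Fin d) →ₗ[ℝ] EuclideanSpace ℝ (Fin d))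

theorem factorial_mul_det_sum_smul_hessian (w : Fin p → ℝ) (x : EuclideanSpace ℝ (Fin d)) :
    (d.factorial : ℝ) * (∑ i, w i • A i x).det =
      ∑ g : Fin d → Fin p, (∏ j, w (g j)) * mixedHessian A g x := by
  have h1 := factorial_mul_det_sum_smul w fun i =>
    LinearMap.toMatrix (EuclideanSpace.basisFun (Fin d) ℝ).toBasis
      (EuclideanSpace.basisFun (Fin d) ℝ).toBasis
      (A i x : EuclideanSpace ℝ (Fin d) →ₗ[ℝ] EuclideanSpace ℝ (Fin d))
  rw [Fintype.card_fin] at h1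
  rw [ContinuousLinearMap.det,
    ← LinearMap.det_toMatrix (EuclideanSpace.basisFun (Fin d) ℝ).toBasis]
  simp only [mixedHessian, ← h1, ContinuousLinearMap.toLinearMap_sum,
    ContinuousLinearMap.toLinearMap_smul, map_sum, map_smul]

theorem continuous_mixedHessian (hA : ∀ i, Continuous (A i)) (g : Fin d → Fin p) :
    Continuous (mixedHessian A g) := by
  refine continuous_finsetSum _ fun σ _ => Continuous.matrix_det ?_
  refine continuous_matrix fun j k => ?_
  simp only [Matrix.of_apply, LinearMap.toMatrix_apply]
  have h1 : Continuous fun x => A (g (σ j)) x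
      ((EuclideanSpace.basisFun (Fin d) ℝ).toBasis k) := (hA _).clm_apply continuous_const
  exact (PiLp.continuous_apply 2 (fun _ => ℝ) j).comp h1

theorem mixedHessian_nonneg (h : ∀ i, IsPotential (K i) (φ i) (G i) (A i)) (g : Fin d → Fin p)
    (x : EuclideanSpace ℝ (Fin d)) : 0 ≤ mixedHessian A g x :=
  (mixedDisc_pos_iff (EuclideanSpace.basisFun (Fin d) ℝ) (fun j => A (g j) x)
    (fun j => (h (g j)).isPositive x)
    (fun j => vectorSpan ℝ (K (g j) : Set (EuclideanSpace ℝ (Fin d))))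
    fun j => (h (g j)).inner_hessian_eq_zero_iff x).1

theorem mixedHessian_pos_iff (h : ∀ i, IsPotential (K i) (φ i) (G i) (A i)) (g : Fin d → Fin p)
    (x : EuclideanSpace ℝ (Fin d)) : 0 < mixedHessian A g x ↔ ∀ J : Finset (Fin d),
      J.card ≤ Module.finrank ℝ
        ↥(⨆ j ∈ J, vectorSpan ℝ (K (g j) : Set (EuclideanSpace ℝ (Fin d)))) :=
  (mixedDisc_pos_iff (EuclideanSpace.basisFun (Fin d) ℝ) (fun j => A (g j) x)
    (fun j => (h (g j)).isPositive x)
    (fun j => vectorSpan ℝ (K (g j) : Set (EuclideanSpace ℝ (Fin d))))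
    fun j => (h (g j)).inner_hessian_eq_zero_iff x).2

/-- Mixed Hessians are nonnegative summands of a multiple of the Hessian determinant of the
potential of `∑ i, K i`, which has finite integral. -/
theorem integrable_mixedHessian (h : ∀ i, IsPotential (K i) (φ i) (G i) (A i))
    (g : Fin d → Fin p) : Integrable (mixedHessian A g) := by
  have h1 := ((IsPotential.sum_smul Finset.univ h fun _ => 1).integrable_det volume).const_mul
    (d.factorial : ℝ)
  refine h1.mono'
    (continuous_mixedHessian (fun i => (h i).continuous_hessian) g).aestronglyMeasurable
    (Filter.Eventually.of_forall fun x => ?_)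
  rw [Real.norm_of_nonneg (mixedHessian_nonneg h g x)]
  have h2 := factorial_mul_det_sum_smul_hessian (A := A) (fun _ => 1) x
  simp only [NNReal.coe_one]
  rw [h2]
  simp only [Finset.prod_const_one, one_mul]
  exact Finset.single_le_sum (f := fun g => mixedHessian A g x)
    (fun g _ => mixedHessian_nonneg h g x) (Finset.mem_univ g)

/-- The criterion for positivity of `mixedHessian A g x` does not depend on `x`, hence it is also
the criterion for positivity of the integral. -/
theorem integral_mixedHessian_pos_iff (h : ∀ i, IsPotential (K i) (φ i) (G i) (A i))
    (g : Fin d → Fin p) : 0 < ∫ x, mixedHessian A g x ↔ ∀ J : Finset (Fin d),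
      J.card ≤ Module.finrank ℝ
        ↥(⨆ j ∈ J, vectorSpan ℝ (K (g j) : Set (EuclideanSpace ℝ (Fin d)))) := by
  rw [integral_pos_iff_support_of_nonneg (mixedHessian_nonneg h g) (integrable_mixedHessian h g)]
  constructor
  · intro h0
    obtain ⟨x, hx⟩ := nonempty_of_measure_ne_zero h0.ne'
    exact (mixedHessian_pos_iff h g x).1
      (lt_of_le_of_ne (mixedHessian_nonneg h g x) (Ne.symm hx))
  · intro h0
    have h1 : Function.support (mixedHessian A g) = Set.univ :=
      Set.eq_univ_of_forall fun x => ((mixedHessian_pos_iff h g x).2 h0).ne'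
    rw [h1]
    exact isOpen_univ.measure_pos _ Set.univ_nonempty

open MvPolynomial in
/-- The volume polynomial, with multiples of the integrals of mixed Hessians as coefficients. -/
theorem isVolumePolynomial_sum (h : ∀ i, IsPotential (K i) (φ i) (G i) (A i)) :
    IsVolumePolynomial K (∑ g : Fin d → Fin p,
      C ((d.factorial : ℝ)⁻¹ * ∫ x, mixedHessian A g x) * ∏ j, X (g j)) := by
  intro w
  rw [← (IsPotential.sum_smul Finset.univ h w).integral_det volume]
  have h1 : ∀ x, (∑ i, (w i : ℝ) • A i x).det = (d.factorial : ℝ)⁻¹ *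
      ∑ g : Fin d → Fin p, (∏ j, (w (g j) : ℝ)) * mixedHessian A g x := fun x => by
    rw [← factorial_mul_det_sum_smul_hessian fun i => (w i : ℝ),
      inv_mul_cancel_left₀ (Nat.cast_ne_zero.2 d.factorial_ne_zero)]
  simp_rw [h1]
  rw [integral_const_mul, integral_finsetSum _ fun g _ => (integrable_mixedHessian h g).const_mul _,
    Finset.mul_sum, map_sum]
  refine Finset.sum_congr rfl fun g _ => ?_
  rw [integral_const_mul, map_mul, map_prod, eval_C]
  simp only [eval_X]
  ring

theorem IsVolumePolynomial.volumePolynomial_eq {d p : ℕ}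
    {K : Fin p → ConvexBody (EuclideanSpace ℝ (Fin d))} {P : MvPolynomial (Fin p) ℝ}
    (hP : IsVolumePolynomial K P) : volumePolynomial K = P := by
  have h : ∃ P, IsVolumePolynomial K P := ⟨P, hP⟩
  rw [volumePolynomial, dif_pos h]
  exact h.choose_spec.unique hP

end

end MixedVol

theorem mainTheorem12 (d p : ℕ) (K : Fin p → ConvexBody (EuclideanSpace ℝ (Fin d))) :
    ((∀ P, MixedVol.IsVolumePolynomial K P ↔ P = MixedVol.volumePolynomial K) ∧
      (MixedVol.volumePolynomial K).IsHomogeneous d) ∧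
    ∀ n : Fin p → ℕ,
      0 < MixedVol.mixedVolume K n ↔
        (∑ i, n i = d ∧ ∀ J : Finset (Fin p), ∑ i ∈ J, n i ≤ MixedVol.dim (∑ i ∈ J, K i)) := by
  choose φ G A h using fun i => MixedVol.exists_isPotential (K i)
  have hvol := MixedVol.isVolumePolynomial_sum h
  have heq := hvol.volumePolynomial_eq
  refine ⟨⟨fun P => ⟨fun hP => hP.volumePolynomial_eq.symm, ?_⟩, ?_⟩, fun n => ?_⟩
  · rintro rfl
    rwa [heq]
  · rw [heq]
    refine MvPolynomial.IsHomogeneous.sum _ _ _ fun g _ => ?_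
    have h1 := MvPolynomial.IsHomogeneous.prod Finset.univ
      (fun j => (MvPolynomial.X (g j) : MvPolynomial (Fin p) ℝ)) (fun _ => 1)
      fun j _ => MvPolynomial.isHomogeneous_X ℝ (g j)
    have h2 := (MvPolynomial.isHomogeneous_C (Fin p)
      ((d.factorial : ℝ)⁻¹ * ∫ x, MixedVol.mixedHessian A g x)).mul h1
    simpa using h2
  · have hmult : (0 : ℝ) < Nat.multinomial Finset.univ n :=
      Nat.cast_pos.2 (Nat.multinomial_pos _ _)
    have hfac : (0 : ℝ) < (d.factorial : ℝ)⁻¹ := inv_pos.2 (Nat.cast_pos.2 d.factorial_pos)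
    have hdim : ∀ J : Finset (Fin p), MixedVol.dim (∑ i ∈ J, K i) =
        Module.finrank ℝ ↥(⨆ i ∈ J, vectorSpan ℝ (K i : Set (EuclideanSpace ℝ (Fin d)))) :=
      fun J => by rw [MixedVol.dim, MixedVol.vectorSpan_coe_sum]
    rw [MixedVol.mixedVolume, div_pos_iff_of_pos_right hmult, heq,
      MixedVol.coeff_sum_C_mul_prod_X, Finset.sum_pos_iff_of_nonneg fun g _ =>
        mul_nonneg hfac.le (MeasureTheory.integral_nonneg (MixedVol.mixedHessian_nonneg h g))]
    simp only [Finset.mem_filter, Finset.mem_univ, true_and, mul_pos_iff_of_pos_left hfac,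
      MixedVol.integral_mixedHessian_pos_iff h, hdim]
    have hsum := MixedVol.exists_fiber_card_eq_iff (κ := Fin d) n
    rw [Fintype.card_fin] at hsum
    rw [← hsum, ← exists_and_right]
    exact exists_congr fun g => and_congr_right fun hg => MixedVol.forall_card_le_iff hg
      fun i => vectorSpan ℝ (K i : Set (EuclideanSpace ℝ (Fin d)))
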